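/- There are absolute constants $c_0,c_1,c_2>0$ such that the following holds for all positive integers $d,s,T$ with $s\mid d$, $s\ge c_0$ and $T\ge c_1 d$. Let $\mathcal X=[-1,1]^d$. A vector $v\in\mathbb R^d$ is $s$-block sparse if, for some integer $i\ge 0$, all its coordinates outside $\{is+1,\dots,(i+1)s\}$ vanish and all its nonzero coordinates have the same absolute value, which lies in $[0,1]$. For such $v$ let $f_v(x)=\|x-v\|_2^2$ for $x\in\mathcal X$, and let $O_v$ be the oracle that answers the $t$-th query $x_t\in\mathcal X$ with the gradient estimate $\hat g_t=2(x_t-X_t)$, where $X_1,X_2,\dots$ are i.i.d. random vectors in $\{-1,1\}^d$ with independent coordinates and mean $v$. Let $\mathcal O_{\mathrm{blsp},s}$ be the set of all pairs $(f_v,O_v)$ with $v$ $s$-block sparse. An oblivious sampling channel, given by a probability vector $(p_1,\dots,p_d)$, maps an input $g\in\mathbb R^d$ to $g(J)e_J$, where $e_1,\dots,e_d$ is the standard basis and the index $J$ is drawn independently of $g$ with $\Pr(J=j)=p_j$; let $\mathcal W_{\mathrm{obl}}$ be the set of these channels. In a nonadaptive strategy $S$ the channels $W_1,\dots,W_T\in\mathcal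 W_{\mathrm{obl}}$ are chosen at the start, possibly at random, and do not depend on the observations. An algorithm $\pi$, possibly randomized (and possibly sharing its random seed with the channel selection; the seed is independent of the oracle's and the channels' randomness), makes $T$ queries $x_1,\dots,x_T\in\mathcal X$. After the query $x_t$ it observes only the output $Y_t$ of the channel $W_t$ on the input $\hat g_t$; each query depends on the seed and the earlier observations, and the output $\hat x\in\mathcal X$ depends on the seed and on $Y_1,\dots,Y_T$. Then $$\inf_{\pi,\,S}\ \sup_{(f,O)\in\mathcal O_{\mathrm{blsp},s}}\mathbb E\Big[f(\hat x)-\min_{x\in\mathcal X}f(x)\Big]\ \ge\ c_2\,\frac{s\,d}{T},$$ where the infimum is over all such algorithms $\pi$ and nonadaptive strategies $S$. -/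

import Mathlib

open MeasureTheory ProbabilityTheory

namespace InfoOpt

/-- The ambient space `ℝ^d` with its Euclidean norm. -/
abbrev E (d : ℕ) := EuclideanSpace ℝ (Fin d)

/-- A (memoryless) first-order oracle: on the query `x` it returns a gradient estimate drawn from
`kernel x`, independently of everything that happened before. -/
structure Oracle (d : ℕ) where
  kernel : Kernel (E d) (E d)
  isMarkov : IsMarkovKernel kernel

/-- A first-order optimization algorithm on the domain `𝒳`, with random seed in `Ω`. The point
`x_t` is a measurable function of the seed and of the messages `Y_0, …, Y_{t-1}` received so far.
In a run with `T` queries, `x_0, …, x_{T-1}` are the queries and `x_T`, computed from all `T`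
messages, is the output. -/
structure Algorithm {d : ℕ} (𝒳 : Set (E d)) (Ω : Type) [MeasurableSpace Ω] where
  point : (t : ℕ) → Ω × (Fin t → E d) → E d
  measurable_point : ∀ t, Measurable (point t)
  point_mem : ∀ t z, point t z ∈ 𝒳

/-- A nonadaptive channel selection strategy for the channel family `𝒲`: the channels
`W_0, W_1, …` are chosen from `𝒲` at the start, possibly at random through the seed,
and do not depend on the messages. -/
structure NonadaptiveStrategy {d : ℕ} (𝒲 : Set (Kernel (E d) (E d)))
    (Ω : Type) [MeasurableSpace Ω] where
  channel : ℕ → Kernel (Ω × E d) (E d)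
  isMarkov : ∀ t, IsMarkovKernel (channel t)
  channel_mem : ∀ t ω, (channel t).sectR ω ∈ 𝒲

section

variable {d : ℕ} {𝒳 : Set (E d)} {𝒲 : Set (Kernel (E d) (E d))} {Ω : Type} [MeasurableSpace Ω]

/-- The conditional law of the message `Y_t` given the seed and the earlier messages: the oracle
is queried at `x_t` and its answer is passed through the channel `W_t`. -/
noncomputable def messageKernel (O : Oracle d) (π : Algorithm 𝒳 Ω) (S : NonadaptiveStrategy 𝒲 Ω)
    (t : ℕ) : Kernel (Ω × (Fin t → E d)) (E d) :=
  S.channel t ∘ₖ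
    (Kernel.deterministic Prod.fst measurable_fst ×ₖ
      O.kernel.comap (π.point t) (π.measurable_point t))

/-- The conditional law of the transcript `(Y_0, …, Y_{t-1})` given the seed. -/
noncomputable def transcript (O : Oracle d) (π : Algorithm 𝒳 Ω) (S : NonadaptiveStrategy 𝒲 Ω) :
    (t : ℕ) → Kernel Ω (Fin t → E d)
  | 0 => Kernel.const Ω (Measure.dirac Fin.elim0)
  | t + 1 => (transcript O π S t ⊗ₖ messageKernel O π S t).map
      (fun z => Fin.snoc (α := fun _ => E d) z.1 z.2)

/-- The expected optimization error `𝔼[f(x_T) - min_{x ∈ 𝒳} f(x)]` after `T` queries, the seed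
having law `ρ`. -/
noncomputable def optError (f : E d → ℝ) (O : Oracle d) (ρ : Measure Ω) (π : Algorithm 𝒳 Ω)
    (S : NonadaptiveStrategy 𝒲 Ω) (T : ℕ) : ENNReal :=
  ∫⁻ ω, ∫⁻ y, ENNReal.ofReal (f (π.point T (ω, y)) - ⨅ x : 𝒳, f x) ∂(transcript O π S T ω) ∂ρ

end

/-- The nonadaptive minmax optimization error for the domain `𝒳`, the class `𝒪` of functions and
oracles, `T` queries and the channel family `𝒲`. -/
noncomputable def minmaxErrorNA {d : ℕ} (𝒳 : Set (E d)) (𝒪 : Set ((E d → ℝ) × Oracle d)) (T : ℕ)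
    (𝒲 : Set (Kernel (E d) (E d))) : ENNReal :=
  ⨅ (Ω : Type) (_ : MeasurableSpace Ω) (ρ : ProbabilityMeasure Ω)
    (π : Algorithm 𝒳 Ω) (S : NonadaptiveStrategy 𝒲 Ω),
    ⨆ fO ∈ 𝒪, optError fO.1 fO.2 (ρ : Measure Ω) π S T

/-- The oblivious sampling channels: coordinate `i` of the input `g` is drawn with a probability
`p i` that does not depend on `g`, and `g(i) e_i` is output. -/
def oblivious (d : ℕ) : Set (Kernel (E d) (E d)) :=
  {W | ∃ p ∈ stdSimplex ℝ (Fin d), ∀ g : E d,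
    W g = ∑ i, ENNReal.ofReal (p i) • Measure.dirac (EuclideanSpace.single i (g i))}

/-- The cube `[-1, 1]^d`. -/
def cube (d : ℕ) : Set (E d) := {x | ∀ i, x i ∈ Set.Icc (-1 : ℝ) 1}

/-- `v` is `s`-block sparse: it vanishes outside one of the blocks `{is, …, (i+1)s - 1}` of
coordinates (numbered from `0`), and its nonzero coordinates have the same absolute value,
which lies in `[0, 1]`. -/
def BlockSparse {d : ℕ} (s : ℕ) (v : E d) : Prop :=
  (∃ i : ℕ, ∀ j : Fin d, ¬(i * s ≤ j ∧ (j : ℕ) < (i + 1) * s) → v j = 0) ∧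
  ∃ a ∈ Set.Icc (0 : ℝ) 1, ∀ j, v j ≠ 0 → |v j| = a

/-- `P` is the law of a random vector with values in `{-1, 1}^d`, with independent coordinates
and mean `v`. -/
structure IsSignLaw {d : ℕ} (v : E d) (P : Measure (E d)) : Prop where
  isProbability : IsProbabilityMeasure P
  sign : ∀ᵐ z ∂P, ∀ i, z i = 1 ∨ z i = -1
  indep : iIndepFun (fun (i : Fin d) (z : E d) => z i) P
  mean : ∀ i, ∫ z, z i ∂P = v i

/-- The class of pairs `(f_v, O_v)`, `v` an `s`-block sparse vector: `f_v(x) = ‖x - v‖²`, and on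
the query `x` the oracle `O_v` returns `2(x - X)` with a fresh copy `X` of a random vector in
`{-1, 1}^d` with independent coordinates and mean `v`. -/
def blockSparseClass (d s : ℕ) : Set ((E d → ℝ) × Oracle d) :=
  {fO | ∃ v : E d, BlockSparse s v ∧ (∀ x, fO.1 x = ‖x - v‖ ^ 2) ∧
    ∃ P : Measure (E d), IsSignLaw v P ∧
      ∀ x, fO.2.kernel x = P.map (fun z => (2 : ℝ) • (x - z))}

end InfoOpt

namespace InfoOpt

/-! Once the seed is fixed, nonadaptivity makes the sampling laws `p t` deterministic. The query is
then known from the earlier messages, so a message carries no more than a sampled index and the sign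
of `X` there. The transcript is thus a function of `T` independent samples whose laws do not involve
the queries (`lintegral_transcript`).

The hard instances put entries `±δ` on one of the `d / s` blocks. Flipping the sign at `j` lowers
the Hellinger affinity of the sample sequences by at most `δ² ∑ₜ p t j`, so Le Cam's bound forces a
squared error of order `δ²` at `j` unless `j` is sampled about `δ⁻²` times on average
(`sum_signs_coordinate_error`). The channels cannot be tuned to the unknown block: the expected
sample counts of all `d` coordinates add up to `T`. With `δ²` of order `d / T`, the sign-averaged
errors of the blocks therefore sum to order `δ² d = d² / T` (`sum_blocks_sum_signs_error`), and
averaging over the `d / s` blocks leaves `s d / T`. -/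

/-! ### Le Cam's two-point bound -/

open Finset in
/-- **Le Cam's inequality** for finite distributions: the squared Hellinger affinity is at most
twice the testing affinity. -/
lemma sq_sum_sqrt_mul_le_two_mul_sum_min {α : Type*} [Fintype α] {P Q : α → ℝ}
    (hP : ∀ a, 0 ≤ P a) (hQ : ∀ a, 0 ≤ Q a) (hP1 : ∑ a, P a = 1) (hQ1 : ∑ a, Q a = 1) :
    (∑ a, √(P a * Q a)) ^ 2 ≤ 2 * ∑ a, min (P a) (Q a) := by
  have hmin : ∀ a, 0 ≤ min (P a) (Q a) := fun a => le_min (hP a) (hQ a)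
  have hmax : ∀ a, 0 ≤ max (P a) (Q a) := fun a => le_max_of_le_left (hP a)
  have hS : 0 ≤ ∑ a, min (P a) (Q a) := sum_nonneg fun a _ => hmin a
  -- Cauchy–Schwarz, after writing `P Q` as `min * max`.
  have hcs : ∑ a, √(P a * Q a) ≤ √(∑ a, min (P a) (Q a)) * √(∑ a, max (P a) (Q a)) := by
    calc ∑ a, √(P a * Q a) = ∑ a, √(min (P a) (Q a)) * √(max (P a) (Q a)) :=
          sum_congr rfl fun a _ => by rw [← Real.sqrt_mul (hmin a), min_mul_max]
      _ ≤ _ := Real.sum_sqrt_mul_sqrt_le _ hmin hmax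
  have hM : ∑ a, max (P a) (Q a) ≤ 2 := by
    calc ∑ a, max (P a) (Q a) ≤ ∑ a, (P a + Q a) :=
          sum_le_sum fun a _ => max_le_add_of_nonneg (hP a) (hQ a)
      _ = 2 := by rw [sum_add_distrib, hP1, hQ1]; norm_num
  calc (∑ a, √(P a * Q a)) ^ 2
      ≤ (√(∑ a, min (P a) (Q a)) * √(∑ a, max (P a) (Q a))) ^ 2 :=
        pow_le_pow_left₀ (sum_nonneg fun a _ => Real.sqrt_nonneg _) hcs 2
    _ = (∑ a, min (P a) (Q a)) * ∑ a, max (P a) (Q a) := by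
        rw [mul_pow, Real.sq_sqrt hS, Real.sq_sqrt (sum_nonneg fun a _ => hmax a)]
    _ ≤ 2 * ∑ a, min (P a) (Q a) := by nlinarith

open Finset in
/-- The two-point lower bound for the squared error. -/
lemma sq_mul_sq_sum_sqrt_le_two_point {α : Type*} [Fintype α] {P Q : α → ℝ}
    (hP : ∀ a, 0 ≤ P a) (hQ : ∀ a, 0 ≤ Q a) (hP1 : ∑ a, P a = 1) (hQ1 : ∑ a, Q a = 1)
    (x : α → ℝ) (δ : ℝ) :
    δ ^ 2 * (∑ a, √(P a * Q a)) ^ 2 ≤ ∑ a, P a * (x a - δ) ^ 2 + ∑ a, Q a * (x a - -δ) ^ 2 := by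
  rw [← sum_add_distrib]
  calc δ ^ 2 * (∑ a, √(P a * Q a)) ^ 2 ≤ δ ^ 2 * (2 * ∑ a, min (P a) (Q a)) :=
        mul_le_mul_of_nonneg_left (sq_sum_sqrt_mul_le_two_mul_sum_min hP hQ hP1 hQ1) (sq_nonneg δ)
    _ = ∑ a, min (P a) (Q a) * (2 * δ ^ 2) := by rw [← sum_mul]; ring
    _ ≤ _ := sum_le_sum fun a _ => ?_
  have h0 : 0 ≤ min (P a) (Q a) := le_min (hP a) (hQ a)
  -- `(x - δ)² + (x + δ)² = 2x² + 2δ²`.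
  calc min (P a) (Q a) * (2 * δ ^ 2)
      ≤ min (P a) (Q a) * (x a - δ) ^ 2 + min (P a) (Q a) * (x a - -δ) ^ 2 := by
        nlinarith [mul_nonneg h0 (sq_nonneg (x a))]
    _ ≤ _ := by gcongr <;> simp

/-! ### Sample laws and their Hellinger affinity -/

/-- The sign encoded by a Boolean. -/
def sgn (b : Bool) : ℝ := if b then 1 else -1

@[simp] lemma sgn_true : sgn true = 1 := rfl

@[simp] lemma sgn_false : sgn false = -1 := rfl

lemma sgn_not (b : Bool) : sgn (!b) = -sgn b := by cases b <;> simp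

lemma sgn_mul_self (b : Bool) : sgn b * sgn b = 1 := by cases b <;> simp

lemma abs_sgn (b : Bool) : |sgn b| = 1 := by cases b <;> simp

variable {d : ℕ}

/-- The probability that coordinate `a.1` is sampled and the sign `a.2` is found there, if
coordinates are sampled with law `p` and the signs have mean `v`. -/
noncomputable def sampleWeight (p : Fin d → ℝ) (v : E d) (a : Fin d × Bool) : ℝ :=
  p a.1 * ((1 + sgn a.2 * v a.1) / 2)

/-- The probability of a sequence of `T` independent samples. -/
noncomputable def pathWeight (p : ℕ → Fin d → ℝ) (v : E d) {T : ℕ} (z : Fin T → Fin d × Bool) :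
    ℝ :=
  ∏ t : Fin T, sampleWeight (p t) v (z t)

lemma one_add_sgn_mul_nonneg {a : ℝ} (ha : a ∈ Set.Icc (-1 : ℝ) 1) (b : Bool) :
    0 ≤ 1 + sgn b * a := by
  obtain ⟨h1, h2⟩ := ha
  cases b <;> simp <;> linarith

lemma sampleWeight_nonneg {p : Fin d → ℝ} (hp : p ∈ stdSimplex ℝ (Fin d)) {v : E d}
    (hv : v ∈ cube d) (a : Fin d × Bool) : 0 ≤ sampleWeight p v a :=
  mul_nonneg (hp.1 _) (div_nonneg (one_add_sgn_mul_nonneg (hv _) _) zero_le_two)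

lemma sum_sampleWeight {p : Fin d → ℝ} (hp : p ∈ stdSimplex ℝ (Fin d)) (v : E d) :
    ∑ a, sampleWeight p v a = 1 := by
  rw [Fintype.sum_prod_type, ← hp.2]
  refine Finset.sum_congr rfl fun i _ => ?_
  simp only [Fintype.sum_bool, sampleWeight, sgn_true, sgn_false]
  ring

lemma pathWeight_nonneg {p : ℕ → Fin d → ℝ} (hp : ∀ t, p t ∈ stdSimplex ℝ (Fin d)) {v : E d}
    (hv : v ∈ cube d) {T : ℕ} (z : Fin T → Fin d × Bool) : 0 ≤ pathWeight p v z :=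
  Finset.prod_nonneg fun _ _ => sampleWeight_nonneg (hp _) hv _

lemma sum_prod_apply {ι α : Type*} [Fintype ι] [DecidableEq ι] [Fintype α] (f : ι → α → ℝ) :
    ∑ z : ι → α, ∏ i, f i (z i) = ∏ i, ∑ a, f i a := by
  rw [Finset.prod_univ_sum, Fintype.piFinset_univ]

lemma sum_pathWeight {p : ℕ → Fin d → ℝ} (hp : ∀ t, p t ∈ stdSimplex ℝ (Fin d)) (v : E d)
    (T : ℕ) : ∑ z : Fin T → Fin d × Bool, pathWeight p v z = 1 := by
  unfold pathWeight
  rw [sum_prod_apply fun (t : Fin T) a => sampleWeight (p t) v a]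
  exact Finset.prod_eq_one fun t _ => sum_sampleWeight (hp t) v

/-- Makes the affinity bound linear in the sampling probabilities, so that it can later be summed
over all coordinates. -/
lemma one_sub_sum_le_prod {ι : Type*} (s : Finset ι) {a : ι → ℝ} (h0 : ∀ i, 0 ≤ a i)
    (h1 : ∀ i, a i ≤ 1) : 1 - ∑ i ∈ s, a i ≤ ∏ i ∈ s, (1 - a i) := by
  classical
  induction s using Finset.induction_on with
  | empty => simp
  | insert i s hi ih =>
    rw [Finset.sum_insert hi, Finset.prod_insert hi]
    nlinarith [mul_le_mul_of_nonneg_left ih (sub_nonneg.2 (h1 i)), h0 i,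
      mul_nonneg (h0 i) (Finset.sum_nonneg fun k (_ : k ∈ s) => h0 k)]

/-- The one-step Hellinger affinity between mean vectors that differ by a sign in a single
coordinate. -/
lemma one_sub_le_sum_sqrt_sampleWeight {p : Fin d → ℝ} (hp : p ∈ stdSimplex ℝ (Fin d))
    {v w : E d} (hv : v ∈ cube d) {j : Fin d} (hj : w j = -v j)
    (hne : ∀ i, i ≠ j → w i = v i) :
    1 - v j ^ 2 * p j ≤ ∑ a, √(sampleWeight p v a * sampleWeight p w a) := by
  have hvj : v j ^ 2 ≤ 1 := by nlinarith [(hv j).1, (hv j).2]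
  have key : ∀ i, p i - (if i = j then v j ^ 2 * p j else 0)
      ≤ ∑ b, √(sampleWeight p v (i, b) * sampleWeight p w (i, b)) := by
    intro i
    by_cases hij : i = j
    · subst hij
      -- Coordinate `j` contributes `p j * √(1 - v j ^ 2)` to the affinity; `u ≤ √u` on `[0, 1]`
      -- removes the root.
      have hs : 1 - v i ^ 2 ≤ √(1 - v i ^ 2) := by
        apply Real.le_sqrt_of_sq_le; nlinarith [sq_nonneg (v i)]
      have hb : ∀ b, √(sampleWeight p v (i, b) * sampleWeight p w (i, b))
          = p i / 2 * √(1 - v i ^ 2) := by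
        intro b
        rw [← Real.sqrt_sq (div_nonneg (hp.1 i) zero_le_two), ← Real.sqrt_mul (sq_nonneg _)]
        congr 1
        simp only [sampleWeight, hj]
        linear_combination -(p i ^ 2 / 4 * v i ^ 2) * sgn_mul_self b
      simp only [hb, Fintype.sum_bool, if_true]
      nlinarith [mul_le_mul_of_nonneg_left hs (hp.1 i)]
    · have hb : ∀ b, √(sampleWeight p v (i, b) * sampleWeight p w (i, b))
          = sampleWeight p v (i, b) := by
        intro b
        have : sampleWeight p w (i, b) = sampleWeight p v (i, b) := by
          simp [sampleWeight, hne i hij]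
        rw [this, Real.sqrt_mul_self (sampleWeight_nonneg hp hv _)]
      simp only [hb, Fintype.sum_bool, hij, if_false]
      simp only [sampleWeight, sgn_true, sgn_false]
      linarith
  rw [Fintype.sum_prod_type]
  refine le_trans (le_of_eq ?_) (Finset.sum_le_sum fun i _ => key i)
  rw [Finset.sum_sub_distrib, hp.2]
  simp

/-- The Hellinger affinity of the sample sequences for mean vectors that differ by a sign in a
single coordinate. -/
lemma one_sub_le_sum_sqrt_pathWeight {p : ℕ → Fin d → ℝ}
    (hp : ∀ t, p t ∈ stdSimplex ℝ (Fin d)) {v w : E d} (hv : v ∈ cube d) (hw : w ∈ cube d)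
    {j : Fin d} (hj : w j = -v j) (hne : ∀ i, i ≠ j → w i = v i) (T : ℕ) :
    1 - v j ^ 2 * ∑ t : Fin T, p t j
      ≤ ∑ z : Fin T → Fin d × Bool, √(pathWeight p v z * pathWeight p w z) := by
  have hvj : v j ^ 2 ≤ 1 := by nlinarith [(hv j).1, (hv j).2]
  have hpj : ∀ t, p t j ≤ 1 := fun t => by
    rw [← (hp t).2]
    exact Finset.single_le_sum (fun i _ => (hp t).1 i) (Finset.mem_univ j)
  have h0 : ∀ t : Fin T, 0 ≤ v j ^ 2 * p t j := fun t => mul_nonneg (sq_nonneg _) ((hp t).1 j)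
  have h1 : ∀ t : Fin T, v j ^ 2 * p t j ≤ 1 := fun t =>
    mul_le_one₀ hvj ((hp t).1 j) (hpj t)
  calc 1 - v j ^ 2 * ∑ t : Fin T, p t j ≤ ∏ t : Fin T, (1 - v j ^ 2 * p t j) := by
        rw [Finset.mul_sum]; exact one_sub_sum_le_prod _ h0 h1
    _ ≤ ∏ t : Fin T, ∑ a, √(sampleWeight (p t) v a * sampleWeight (p t) w a) :=
        Finset.prod_le_prod (fun t _ => sub_nonneg.2 (h1 t)) fun t _ =>
          one_sub_le_sum_sqrt_sampleWeight (hp t) hv hj hne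
    -- Affinity is multiplicative over independent samples.
    _ = ∑ z : Fin T → Fin d × Bool, √(pathWeight p v z * pathWeight p w z) := by
        rw [← sum_prod_apply fun (t : Fin T) a =>
          √(sampleWeight (p t) v a * sampleWeight (p t) w a)]
        refine Finset.sum_congr rfl fun z _ => ?_
        rw [pathWeight, pathWeight, ← Finset.prod_mul_distrib,
          Real.sqrt_prod _ fun t _ => mul_nonneg (sampleWeight_nonneg (hp _) hv _)
            (sampleWeight_nonneg (hp _) hw _)]

/-! ### Hard instances and the Assouad argument -/

/-- The vector with entries `±δ`, with signs `σ`, in block `b` and zeros elsewhere. -/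
noncomputable def blockVector (s b : ℕ) (δ : ℝ) (σ : Fin d → Bool) : E d :=
  WithLp.toLp 2 fun j => if (j : ℕ) / s = b then δ * sgn (σ j) else 0

lemma blockVector_apply (s b : ℕ) (δ : ℝ) (σ : Fin d → Bool) (j : Fin d) :
    blockVector s b δ σ j = if (j : ℕ) / s = b then δ * sgn (σ j) else 0 := rfl

lemma blockVector_mem_cube (s b : ℕ) {δ : ℝ} (h0 : 0 ≤ δ) (h1 : δ ≤ 1) (σ : Fin d → Bool) :
    blockVector s b δ σ ∈ cube d := by
  intro j
  rw [blockVector_apply, Set.mem_Icc, ← abs_le]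
  split_ifs
  · rwa [abs_mul, abs_sgn, mul_one, abs_of_nonneg h0]
  · simp

lemma blockSparse_blockVector {s : ℕ} (hs : 0 < s) (b : ℕ) {δ : ℝ} (h0 : 0 ≤ δ) (h1 : δ ≤ 1)
    (σ : Fin d → Bool) : BlockSparse s (blockVector s b δ σ) := by
  refine ⟨⟨b, fun j hj => ?_⟩, δ, ⟨h0, h1⟩, fun j hj => ?_⟩
  · rw [blockVector_apply, if_neg]
    intro h
    apply hj
    rwa [Nat.div_eq_iff hs, Nat.le_sub_one_iff_lt (by positivity), ← Nat.succ_mul] at h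
  · rw [blockVector_apply] at hj ⊢
    split_ifs at hj ⊢
    · rw [abs_mul, abs_sgn, mul_one, abs_of_nonneg h0]
    · exact absurd rfl hj

/-- Flipping the sign in coordinate `j`. -/
def flipSign (j : Fin d) : (Fin d → Bool) ≃ (Fin d → Bool) where
  toFun σ := Function.update σ j (!σ j)
  invFun σ := Function.update σ j (!σ j)
  left_inv σ := by simp
  right_inv σ := by simp

/-- The squared error in coordinate `j`, summed over all signs of the block containing `j`. -/
lemma sum_signs_coordinate_error {p : ℕ → Fin d → ℝ} (hp : ∀ t, p t ∈ stdSimplex ℝ (Fin d))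
    {s b : ℕ} {δ : ℝ} (h0 : 0 ≤ δ) (h1 : δ ≤ 1) {j : Fin d} (hj : (j : ℕ) / s = b) {T : ℕ}
    (x : (Fin T → Fin d × Bool) → ℝ) :
    2 ^ d * (δ ^ 2 / 2 * (1 - 2 * δ ^ 2 * ∑ t : Fin T, p t j)) ≤
      ∑ σ, ∑ z, pathWeight p (blockVector s b δ σ) z * (x z - blockVector s b δ σ j) ^ 2 := by
  set A : (Fin d → Bool) → ℝ := fun σ =>
    ∑ z, pathWeight p (blockVector s b δ σ) z * (x z - blockVector s b δ σ j) ^ 2 with hA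
  have key : ∀ σ, δ ^ 2 * (1 - 2 * δ ^ 2 * ∑ t : Fin T, p t j) ≤ A σ + A (flipSign j σ) := by
    intro σ
    set v := blockVector s b δ σ with hv
    set w := blockVector s b δ (flipSign j σ) with hw
    have hvc : v ∈ cube d := blockVector_mem_cube s b h0 h1 σ
    have hwc : w ∈ cube d := blockVector_mem_cube s b h0 h1 _
    have hvj : v j ^ 2 = δ ^ 2 := by
      rw [hv, blockVector_apply, if_pos hj, mul_pow, pow_two (sgn _), sgn_mul_self, mul_one]
    have hwj : w j = -v j := by
      rw [hv, hw, blockVector_apply, blockVector_apply, if_pos hj, if_pos hj]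
      simp [flipSign, sgn_not]
    have hne : ∀ i, i ≠ j → w i = v i := by
      intro i hi
      rw [hv, hw, blockVector_apply, blockVector_apply]
      simp [flipSign, hi]
    have h2 := sq_mul_sq_sum_sqrt_le_two_point (P := fun z => pathWeight p v z)
      (Q := fun z => pathWeight p w z) (fun z => pathWeight_nonneg hp hvc z)
      (fun z => pathWeight_nonneg hp hwc z) (sum_pathWeight hp v T) (sum_pathWeight hp w T) x (v j)
    have h3 := one_sub_le_sum_sqrt_pathWeight hp hvc hwc hwj hne T
    rw [hvj] at h2 h3
    have hS : 0 ≤ ∑ z : Fin T → Fin d × Bool, √(pathWeight p v z * pathWeight p w z) :=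
      Finset.sum_nonneg fun z _ => Real.sqrt_nonneg _
    have hA1 : A σ = ∑ z, pathWeight p v z * (x z - v j) ^ 2 := rfl
    have hA2 : A (flipSign j σ) = ∑ z, pathWeight p w z * (x z - -v j) ^ 2 := by
      rw [← hwj]
    rw [hA1, hA2]
    refine le_trans (mul_le_mul_of_nonneg_left ?_ (sq_nonneg δ)) h2
    -- `S² ≥ 2S - 1` for every real `S`, so the lower bound on the affinity `S` may be negative.
    nlinarith [sq_nonneg ((∑ z : Fin T → Fin d × Bool,
      √(pathWeight p v z * pathWeight p w z)) - 1)]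
  -- Summing over all `σ` counts each sign pattern twice, whence the factor `1 / 2` in the bound.
  have hsum := Finset.sum_le_sum fun σ (_ : σ ∈ Finset.univ) => key σ
  rw [Finset.sum_add_distrib, Equiv.sum_comp (flipSign j) A] at hsum
  simp only [Finset.sum_const, Finset.card_univ, Fintype.card_pi, Fintype.card_bool,
    Finset.prod_const, Fintype.card_fin, nsmul_eq_mul, Nat.cast_pow, Nat.cast_ofNat] at hsum
  linarith

/-- **Assouad-type bound**: the squared error summed over all blocks and all signs. -/
lemma sum_blocks_sum_signs_error {p : ℕ → Fin d → ℝ} (hp : ∀ t, p t ∈ stdSimplex ℝ (Fin d))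
    {s : ℕ} (hsd : s ∣ d) {δ : ℝ} (h0 : 0 ≤ δ) (h1 : δ ≤ 1) {T : ℕ}
    (x : (Fin T → Fin d × Bool) → E d) :
    2 ^ d * (δ ^ 2 / 2 * (d - 2 * δ ^ 2 * T)) ≤
      ∑ b ∈ Finset.range (d / s), ∑ σ, ∑ z,
        pathWeight p (blockVector s b δ σ) z * ‖x z - blockVector s b δ σ‖ ^ 2 := by
  have hmaps : ∀ j ∈ (Finset.univ : Finset (Fin d)), (j : ℕ) / s ∈ Finset.range (d / s) :=
    fun j _ => Finset.mem_range.2 (Nat.div_lt_div_of_lt_of_dvd hsd j.2)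
  -- The sampling budget: each `p t` has total mass `1`, so the expected counts sum to `T`.
  have hsum : ∑ j : Fin d, 2 ^ d * (δ ^ 2 / 2 * (1 - 2 * δ ^ 2 * ∑ t : Fin T, p t j))
      = 2 ^ d * (δ ^ 2 / 2 * (d - 2 * δ ^ 2 * T)) := by
    rw [← Finset.mul_sum, ← Finset.mul_sum, Finset.sum_sub_distrib, ← Finset.mul_sum,
      Finset.sum_comm]
    simp [(hp _).2]
  rw [← hsum, ← Finset.sum_fiberwise_of_maps_to hmaps]
  refine Finset.sum_le_sum fun b _ => ?_
  calc _ ≤ ∑ j ∈ Finset.univ.filter fun j : Fin d => (j : ℕ) / s = b, ∑ σ, ∑ z, pathWeight p (blockVector s b δ σ) z *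
          (x z j - blockVector s b δ σ j) ^ 2 :=
        Finset.sum_le_sum fun j hj =>
          sum_signs_coordinate_error hp h0 h1 (Finset.mem_filter.1 hj).2 _
    _ = ∑ σ, ∑ z, pathWeight p (blockVector s b δ σ) z *
          ∑ j ∈ Finset.univ.filter fun j : Fin d => (j : ℕ) / s = b, (x z j - blockVector s b δ σ j) ^ 2 := by
        rw [Finset.sum_comm]
        refine Finset.sum_congr rfl fun σ _ => ?_
        rw [Finset.sum_comm]
        simp_rw [Finset.mul_sum]
    -- Errors outside the block are discarded.
    _ ≤ _ := by
        refine Finset.sum_le_sum fun σ _ => Finset.sum_le_sum fun z _ => ?_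
        refine mul_le_mul_of_nonneg_left ?_
          (pathWeight_nonneg hp (blockVector_mem_cube s b h0 h1 σ) z)
        rw [EuclideanSpace.real_norm_sq_eq]
        exact Finset.sum_le_sum_of_subset_of_nonneg (Finset.filter_subset _ _)
          fun j _ _ => sq_nonneg _

/-! ### Construction of the sign laws and oracles -/

/-- The law of a random sign with mean `a`. -/
noncomputable def signMeasure (a : ℝ) : Measure ℝ :=
  ∑ b, ENNReal.ofReal ((1 + sgn b * a) / 2) • Measure.dirac (sgn b)

lemma lintegral_signMeasure (a : ℝ) (F : ℝ → ENNReal) :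
    ∫⁻ x, F x ∂signMeasure a = ∑ b, ENNReal.ofReal ((1 + sgn b * a) / 2) * F (sgn b) := by
  simp [signMeasure, lintegral_add_measure]

lemma isProbabilityMeasure_signMeasure {a : ℝ} (ha : a ∈ Set.Icc (-1 : ℝ) 1) :
    IsProbabilityMeasure (signMeasure a) := by
  refine ⟨?_⟩
  rw [← lintegral_one, lintegral_signMeasure]
  simp only [mul_one]
  rw [← ENNReal.ofReal_sum_of_nonneg
    fun b _ => div_nonneg (one_add_sgn_mul_nonneg ha b) zero_le_two]
  simp only [Fintype.sum_bool, sgn_true, sgn_false]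
  ring_nf
  simp

lemma ae_signMeasure (a : ℝ) : ∀ᵐ x ∂signMeasure a, x = 1 ∨ x = -1 := by
  simp [signMeasure, ae_iff]

lemma integral_signMeasure {a : ℝ} (ha : a ∈ Set.Icc (-1 : ℝ) 1) :
    ∫ x, x ∂signMeasure a = a := by
  unfold signMeasure
  rw [integral_finsetSum_measure fun b _ =>
    (integrable_dirac (by simp)).smul_measure ENNReal.ofReal_ne_top]
  simp only [integral_smul_measure, integral_dirac]
  simp only [Fintype.sum_bool,
    ENNReal.toReal_ofReal (div_nonneg (one_add_sgn_mul_nonneg ha _) zero_le_two), sgn_true,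
    sgn_false, smul_eq_mul]
  ring

/-- The law of a random vector with independent sign coordinates and mean `v`. -/
noncomputable def signVectorMeasure (v : E d) : Measure (E d) :=
  (Measure.pi fun i => signMeasure (v i)).map (WithLp.toLp 2)

section

variable {v : E d}

lemma isProbabilityMeasure_signVectorMeasure (hv : v ∈ cube d) :
    IsProbabilityMeasure (signVectorMeasure v) := by
  have := fun i => isProbabilityMeasure_signMeasure (hv i)
  exact Measure.isProbabilityMeasure_map (by fun_prop)

lemma map_eval_signVectorMeasure (hv : v ∈ cube d) (i : Fin d) :
    (signVectorMeasure v).map (fun z => z i) = signMeasure (v i) := by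
  have := fun i => isProbabilityMeasure_signMeasure (hv i)
  rw [signVectorMeasure, Measure.map_map (by fun_prop) (by fun_prop)]
  exact (measurePreserving_eval (fun i => signMeasure (v i)) i).map_eq

lemma isSignLaw_signVectorMeasure (hv : v ∈ cube d) : IsSignLaw v (signVectorMeasure v) := by
  have := fun i => isProbabilityMeasure_signMeasure (hv i)
  have := isProbabilityMeasure_signVectorMeasure hv
  refine ⟨inferInstance, ?_, ?_, fun i => ?_⟩
  · rw [ae_all_iff]
    intro i
    have h := ae_signMeasure (v i)
    rw [← map_eval_signVectorMeasure hv i] at h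
    exact ae_of_ae_map (by fun_prop) h
  · rw [iIndepFun_iff_map_fun_eq_pi_map fun i => by fun_prop]
    simp only [map_eval_signVectorMeasure hv]
    rw [signVectorMeasure, Measure.map_map (by fun_prop) (by fun_prop)]
    exact Measure.map_id
  · rw [← integral_map (f := fun x : ℝ => x) (φ := fun z : E d => z i) (by fun_prop)
      (by fun_prop), map_eval_signVectorMeasure hv, integral_signMeasure (hv i)]

end

/-- The oracle that answers `x` with `2(x - X)`, where `X` has law `P`. -/
noncomputable def gradientOracle (P : Measure (E d)) [IsProbabilityMeasure P] : Oracle d where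
  kernel := (Kernel.id ×ₖ Kernel.const (E d) P).map fun z => (2 : ℝ) • (z.1 - z.2)
  isMarkov := Kernel.IsMarkovKernel.map _ (by fun_prop)

lemma gradientOracle_kernel_apply (P : Measure (E d)) [IsProbabilityMeasure P] (x : E d) :
    (gradientOracle P).kernel x = P.map fun z => (2 : ℝ) • (x - z) := by
  rw [gradientOracle, Kernel.map_apply _ (by fun_prop), Kernel.prod_apply, Kernel.id_apply,
    Kernel.const_apply, Measure.dirac_prod, Measure.map_map (by fun_prop) (by fun_prop)]
  rfl

instance (O : Oracle d) : IsMarkovKernel O.kernel := O.isMarkov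

/-! ### The transcript as a function of independent samples -/

variable {𝒳 : Set (E d)} {𝒲 : Set (Kernel (E d) (E d))} {Ω : Type} [MeasurableSpace Ω]

instance (S : NonadaptiveStrategy 𝒲 Ω) (t : ℕ) : IsMarkovKernel (S.channel t) := S.isMarkov t

instance (O : Oracle d) (π : Algorithm 𝒳 Ω) (S : NonadaptiveStrategy 𝒲 Ω) (t : ℕ) :
    IsMarkovKernel (messageKernel O π S t) := by
  unfold messageKernel; infer_instance

lemma measurable_finSnoc {α : Type*} [MeasurableSpace α] (t : ℕ) :
    Measurable fun z : (Fin t → α) × α => Fin.snoc (α := fun _ => α) z.1 z.2 := by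
  refine measurable_pi_iff.2 fun i => ?_
  refine Fin.lastCases ?_ (fun i => ?_) i
  · simpa using measurable_snd
  · simp only [Fin.snoc_castSucc]
    fun_prop

instance (O : Oracle d) (π : Algorithm 𝒳 Ω) (S : NonadaptiveStrategy 𝒲 Ω) (t : ℕ) :
    IsMarkovKernel (transcript O π S t) := by
  induction t with
  | zero => unfold transcript; infer_instance
  | succ t ih => exact Kernel.IsMarkovKernel.map _ (measurable_finSnoc t)

lemma measurable_single (i : Fin d) :
    Measurable fun c : ℝ => (EuclideanSpace.single i c : E d) := by
  have h : (fun c : ℝ => (EuclideanSpace.single i c : E d))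
      = fun c => c • EuclideanSpace.single i (1 : ℝ) := by
    ext c j; simp
  rw [h]
  fun_prop

/-- The message that results from the query `x` if coordinate `a.1` is sampled and the random
vector of the oracle has the sign `a.2` there. -/
noncomputable def message (x : E d) (a : Fin d × Bool) : E d :=
  EuclideanSpace.single a.1 (2 * (x a.1 - sgn a.2))

/-- The channel passes on a single coordinate, so only the one-dimensional marginals of the law of
`X` enter. The query affects the values of the messages but not their weights. -/
lemma lintegral_messageKernel {O : Oracle d} {v : E d} (hv : v ∈ cube d)
    (hO : ∀ x, O.kernel x = (signVectorMeasure v).map fun z => (2 : ℝ) • (x - z))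
    (π : Algorithm 𝒳 Ω) (S : NonadaptiveStrategy 𝒲 Ω) {t : ℕ} {ω : Ω} {p : Fin d → ℝ}
    (hp : p ∈ stdSimplex ℝ (Fin d))
    (hS : ∀ g, S.channel t (ω, g)
      = ∑ i, ENNReal.ofReal (p i) • Measure.dirac (EuclideanSpace.single i (g i)))
    (y : Fin t → E d) {F : E d → ENNReal} (hF : Measurable F) :
    ∫⁻ m, F m ∂messageKernel O π S t (ω, y)
      = ∑ a, ENNReal.ofReal (sampleWeight p v a) * F (message (π.point t (ω, y)) a) := by
  have hF' : ∀ i : Fin d, Measurable fun c : ℝ => F (EuclideanSpace.single i c) :=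
    fun i => hF.comp (measurable_single i)
  rw [messageKernel, Kernel.lintegral_comp _ _ _ hF,
    Kernel.lintegral_deterministic_prod _ _ _ hF.lintegral_kernel, Kernel.comap_apply, hO,
    lintegral_map (by fun_prop) (by fun_prop)]
  have hF'' : ∀ i : Fin d, Measurable fun z : E d =>
      F (EuclideanSpace.single i (((2 : ℝ) • (π.point t (ω, y) - z)) i)) :=
    fun i => (hF' i).comp (by fun_prop)
  simp only [hS, lintegral_finsetSum_measure, lintegral_smul_measure, lintegral_dirac, smul_eq_mul]
  rw [lintegral_finsetSum _ fun i _ => (hF'' i).const_mul _, Fintype.sum_prod_type]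
  refine Finset.sum_congr rfl fun i _ => ?_
  rw [lintegral_const_mul _ (hF'' i)]
  have hmap := lintegral_map (μ := signVectorMeasure v) (g := fun z : E d => z i)
    (f := fun c : ℝ => F (EuclideanSpace.single i (2 * (π.point t (ω, y) i - c))))
    ((hF' i).comp (by fun_prop)) (by fun_prop)
  rw [map_eval_signVectorMeasure hv, lintegral_signMeasure] at hmap
  simp only [PiLp.smul_apply, PiLp.sub_apply, smul_eq_mul]
  rw [← hmap, Finset.mul_sum]
  refine Finset.sum_congr rfl fun b _ => ?_
  rw [← mul_assoc, sampleWeight, ENNReal.ofReal_mul (hp.1 i)]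
  rfl

/-- The transcript as a function of the sampled coordinates and signs. -/
noncomputable def transcriptOf (π : Algorithm 𝒳 Ω) (ω : Ω) :
    (t : ℕ) → (Fin t → Fin d × Bool) → Fin t → E d
  | 0, _ => Fin.elim0
  | t + 1, z => Fin.snoc (α := fun _ => E d) (transcriptOf π ω t (Fin.init z))
      (message (π.point t (ω, transcriptOf π ω t (Fin.init z))) (z (Fin.last t)))

/-- Given the seed, the law of the transcript has finite support. -/
lemma lintegral_transcript {O : Oracle d} {v : E d} (hv : v ∈ cube d)
    (hO : ∀ x, O.kernel x = (signVectorMeasure v).map fun z => (2 : ℝ) • (x - z))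
    (π : Algorithm 𝒳 Ω) (S : NonadaptiveStrategy 𝒲 Ω) {ω : Ω} {p : ℕ → Fin d → ℝ}
    (hp : ∀ t, p t ∈ stdSimplex ℝ (Fin d))
    (hS : ∀ t g, S.channel t (ω, g)
      = ∑ i, ENNReal.ofReal (p t i) • Measure.dirac (EuclideanSpace.single i (g i)))
    (T : ℕ) {F : (Fin T → E d) → ENNReal} (hF : Measurable F) :
    ∫⁻ y, F y ∂transcript O π S T ω
      = ∑ z, ENNReal.ofReal (pathWeight p v z) * F (transcriptOf π ω T z) := by
  induction T with
  | zero =>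
    rw [transcript, Kernel.const_apply, lintegral_dirac]
    simp [pathWeight, transcriptOf]
  | succ T ih =>
    have hF' : Measurable fun w : (Fin T → E d) × E d =>
        F (Fin.snoc (α := fun _ => E d) w.1 w.2) := hF.comp (measurable_finSnoc T)
    rw [transcript, Kernel.map_apply _ (measurable_finSnoc T),
      lintegral_map hF (measurable_finSnoc T), Kernel.lintegral_compProd _ _ _ hF',
      ih (hF'.lintegral_kernel_prod_right'' (η := messageKernel O π S T) (a := ω)),
      ← (Fin.snocEquiv fun _ : Fin (T + 1) => Fin d × Bool).sum_comp, Fintype.sum_prod_type_right]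
    refine Finset.sum_congr rfl fun z _ => ?_
    rw [lintegral_messageKernel hv hO π S (hp T) (hS T) _
      (F := fun m => F (Fin.snoc (α := fun _ => E d) (transcriptOf π ω T z) m))
      (hF'.comp measurable_prodMk_left), Finset.mul_sum]
    refine Finset.sum_congr rfl fun a _ => ?_
    have hz : pathWeight p v (Fin.snocEquiv (fun _ : Fin (T + 1) => Fin d × Bool) (a, z))
        = pathWeight p v z * sampleWeight (p T) v a := by
      simp [pathWeight, Fin.snocEquiv, Fin.prod_univ_castSucc]
    rw [hz, ENNReal.ofReal_mul (pathWeight_nonneg hp hv z), mul_assoc]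
    simp [transcriptOf, Fin.snocEquiv]

/-! ### From the sample bound to the minmax error -/

/-- The oracle of the class for the mean vector `v`. -/
noncomputable def signOracle {v : E d} (hv : v ∈ cube d) : Oracle d :=
  have := isProbabilityMeasure_signVectorMeasure hv
  gradientOracle (signVectorMeasure v)

lemma signOracle_kernel_apply {v : E d} (hv : v ∈ cube d) (x : E d) :
    (signOracle hv).kernel x = (signVectorMeasure v).map fun z => (2 : ℝ) • (x - z) :=
  have := isProbabilityMeasure_signVectorMeasure hv
  gradientOracle_kernel_apply _ x

/-- The squared distance attains the minimum `0` on the cube. -/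
lemma iInf_sq_dist_cube {v : E d} (hv : v ∈ cube d) :
    ⨅ x : cube d, ‖(x : E d) - v‖ ^ 2 = 0 := by
  refine le_antisymm ?_ (Real.iInf_nonneg fun x => sq_nonneg _)
  refine (ciInf_le ⟨0, ?_⟩ ⟨v, hv⟩).trans (by simp)
  rintro _ ⟨x, rfl⟩
  exact sq_nonneg _

/-- The Assouad bound summed over the hard instances, for an arbitrary algorithm. -/
lemma le_sum_optError {s : ℕ} (hsd : s ∣ d) {δ : ℝ} (h0 : 0 ≤ δ) (h1 : δ ≤ 1) (T : ℕ)
    (ρ : ProbabilityMeasure Ω) (π : Algorithm (cube d) Ω)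
    (S : NonadaptiveStrategy (oblivious d) Ω) :
    ENNReal.ofReal (2 ^ d * (δ ^ 2 / 2 * (d - 2 * δ ^ 2 * T))) ≤
      ∑ b ∈ Finset.range (d / s), ∑ σ : Fin d → Bool,
        optError (fun x => ‖x - blockVector s b δ σ‖ ^ 2)
          (signOracle (blockVector_mem_cube s b h0 h1 σ)) (ρ : Measure Ω) π S T := by
  have hmeas : ∀ b (σ : Fin d → Bool), Measurable fun u : Ω × (Fin T → E d) =>
      ENNReal.ofReal (‖π.point T u - blockVector s b δ σ‖ ^ 2) := fun b σ => by
    have := π.measurable_point T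
    fun_prop
  simp only [optError, iInf_sq_dist_cube (blockVector_mem_cube s _ h0 h1 _), sub_zero]
  have hm : ∀ b (σ : Fin d → Bool), Measurable fun ω => ∫⁻ y,
      ENNReal.ofReal (‖π.point T (ω, y) - blockVector s b δ σ‖ ^ 2)
        ∂transcript (signOracle (blockVector_mem_cube s b h0 h1 σ)) π S T ω :=
    fun b σ => (hmeas b σ).lintegral_kernel_prod_right'
  -- The instances are summed inside the integral over the seed: `p` depends on `ω`, but for fixed
  -- `ω` one `p` serves all instances.
  simp_rw [← lintegral_finsetSum _ fun σ _ => hm _ σ]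
  rw [← lintegral_finsetSum _ fun b _ => Finset.measurable_fun_sum _ fun σ _ => hm b σ]
  calc _ = ∫⁻ _, ENNReal.ofReal (2 ^ d * (δ ^ 2 / 2 * (d - 2 * δ ^ 2 * T))) ∂(ρ : Measure Ω) := by
        simp
    _ ≤ _ := lintegral_mono fun ω => ?_
  choose p hp hS using fun t => S.channel_mem t ω
  have hF := fun b σ => (hmeas b σ).comp (measurable_prodMk_left (x := ω))
  have hlaw : ∀ b (σ : Fin d → Bool), ∫⁻ y,
      ENNReal.ofReal (‖π.point T (ω, y) - blockVector s b δ σ‖ ^ 2)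
        ∂transcript (signOracle (blockVector_mem_cube s b h0 h1 σ)) π S T ω
      = ENNReal.ofReal (∑ z, pathWeight p (blockVector s b δ σ) z *
          ‖π.point T (ω, transcriptOf π ω T z) - blockVector s b δ σ‖ ^ 2) := fun b σ => by
    have hc := blockVector_mem_cube s b h0 h1 σ
    refine (lintegral_transcript hc (signOracle_kernel_apply hc) π S hp
      (fun t g => by rw [← hS t g, Kernel.sectR_apply]) T (hF b σ)).trans ?_
    rw [ENNReal.ofReal_sum_of_nonneg fun z _ =>
      mul_nonneg (pathWeight_nonneg hp hc z) (sq_nonneg _)]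
    exact Finset.sum_congr rfl fun z _ => (ENNReal.ofReal_mul (pathWeight_nonneg hp hc z)).symm
  have hnn : ∀ b (σ : Fin d → Bool), 0 ≤ ∑ z : Fin T → Fin d × Bool,
      pathWeight p (blockVector s b δ σ) z *
        ‖π.point T (ω, transcriptOf π ω T z) - blockVector s b δ σ‖ ^ 2 := fun b σ =>
    Finset.sum_nonneg fun z _ => mul_nonneg
      (pathWeight_nonneg hp (blockVector_mem_cube s b h0 h1 σ) z) (sq_nonneg _)
  simp only [hlaw]
  simp_rw [← ENNReal.ofReal_sum_of_nonneg fun σ _ => hnn _ σ]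
  rw [← ENNReal.ofReal_sum_of_nonneg fun b _ => Finset.sum_nonneg fun σ _ => hnn b σ]
  exact ENNReal.ofReal_le_ofReal (sum_blocks_sum_signs_error hp hsd h0 h1 _)

lemma mem_blockSparseClass {s : ℕ} (hs : 0 < s) (b : ℕ) {δ : ℝ} (h0 : 0 ≤ δ) (h1 : δ ≤ 1)
    (σ : Fin d → Bool) :
    ((fun x => ‖x - blockVector s b δ σ‖ ^ 2), signOracle (blockVector_mem_cube s b h0 h1 σ)) ∈
      blockSparseClass d s :=
  ⟨blockVector s b δ σ, blockSparse_blockVector hs b h0 h1 σ, fun _ => rfl,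
    signVectorMeasure (blockVector s b δ σ),
    isSignLaw_signVectorMeasure (blockVector_mem_cube s b h0 h1 σ),
    signOracle_kernel_apply (blockVector_mem_cube s b h0 h1 σ)⟩

end InfoOpt

open InfoOpt

theorem theoremt :
    ∃ c₀ c₁ c₂ : ℝ, 0 < c₀ ∧ 0 < c₁ ∧ 0 < c₂ ∧
      ∀ d s T : ℕ, 0 < d → s ∣ d → c₀ ≤ (s : ℝ) → c₁ * (d : ℝ) ≤ (T : ℝ) →
        ENNReal.ofReal (c₂ * ((s : ℝ) * (d : ℝ) / (T : ℝ))) ≤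
          InfoOpt.minmaxErrorNA (InfoOpt.cube d) (InfoOpt.blockSparseClass d s) T
            (InfoOpt.oblivious d) := by
  refine ⟨1, 1, 1 / 16, one_pos, one_pos, by norm_num, fun d s T hd hsd hs hT => ?_⟩
  have hs0 : 0 < s := Nat.pos_of_dvd_of_pos hsd hd
  rw [one_mul] at hT
  have hd' : (0 : ℝ) < d := Nat.cast_pos.2 hd
  have hT' : (0 : ℝ) < T := hd'.trans_le hT
  -- `δ² = d / (4T)` makes `d - 2δ²T = d / 2`, so the total is `2 ^ d * d² / (16T)`; `d ≤ T` ensures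
  -- `δ ≤ 1`.
  have h0 := Real.sqrt_nonneg ((d : ℝ) / (4 * T))
  have hδ := Real.sq_sqrt (x := (d : ℝ) / (4 * T)) (by positivity)
  have h1 : √((d : ℝ) / (4 * T)) ≤ 1 := by
    rw [Real.sqrt_le_one, div_le_one (by positivity)]
    linarith
  set δ := √((d : ℝ) / (4 * T))
  unfold minmaxErrorNA
  refine le_iInf fun Ω => le_iInf fun _ => le_iInf fun ρ => le_iInf fun π => le_iInf fun S => ?_
  set A := ⨆ fO ∈ blockSparseClass d s, optError fO.1 fO.2 (ρ : Measure Ω) π S T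
  obtain ⟨m, rfl⟩ := hsd
  have hm : 0 < m := Nat.pos_of_mul_pos_left hd
  -- Each of the `m * 2 ^ d` instances, `m = d / s`, has error at most the supremum `A`.
  have hsum : ENNReal.ofReal (2 ^ (s * m) * (δ ^ 2 / 2 * ((s * m : ℕ) - 2 * δ ^ 2 * T)))
      ≤ ENNReal.ofReal (m * 2 ^ (s * m)) * A := by
    refine (le_sum_optError (dvd_mul_right s m) h0 h1 T ρ π S).trans ?_
    refine (Finset.sum_le_sum fun b _ => Finset.sum_le_sum fun σ _ =>
      le_iSup₂_of_le (f := fun fO (_ : fO ∈ blockSparseClass (s * m) s) =>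
        optError fO.1 fO.2 (ρ : Measure Ω) π S T) _ (mem_blockSparseClass hs0 b h0 h1 σ)
        le_rfl).trans (le_of_eq ?_)
    rw [Finset.sum_const, Finset.sum_const, Nat.mul_div_cancel_left m hs0, Finset.card_range,
      smul_smul, nsmul_eq_mul]
    congr 1
    rw [← ENNReal.ofReal_natCast]
    simp
  have hK : (0 : ℝ) < m * 2 ^ (s * m) := by positivity
  rw [← ENNReal.mul_le_mul_iff_right (ENNReal.ofReal_pos.2 hK).ne' ENNReal.ofReal_ne_top,
    ← ENNReal.ofReal_mul hK.le]
  refine le_trans (le_of_eq (congrArg ENNReal.ofReal ?_)) hsum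
  rw [hδ]
  push_cast
  field_simp
  ring
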